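/- **Conventions.** Let $\mathcal C$ be a triangulated category. A $t$-structure $\mathcal D$ on $\mathcal C$ is given by strictly full subcategories $\mathcal D^{\le m}=\mathcal D^{\le 0}[-m]$, $\mathcal D^{\ge m}=\mathcal D^{\ge 0}[-m]$ ($m\in\mathbb Z$); its heart is $\mathcal H_{\mathcal D}=\mathcal D^{\le 0}\cap\mathcal D^{\ge 0}$, and $\mathcal D^{\ge 0}$ is called its co-aisle. A pair $(\mathcal D,\mathcal T)$ of $t$-structures on $\mathcal C$ is *right filterable* if $\mathcal D^{\ge i}\cap\mathcal T^{\ge 0}$ is the co-aisle of a $t$-structure for every $i\in\mathbb Z$. It is *of type $(n,k)$*, with $n\in\mathbb N$ and $k\in\mathbb Z$, if $k$ is the largest integer with $\mathcal T^{\le k}\subseteq\mathcal D^{\le 0}$ and $n$ is the least natural number with $\mathcal D^{\le -n}\subseteq\mathcal T^{\le k}$. For a right filterable pair let $\mathcal D_i$ be the unique $t$-structure with co-aisle $\mathcal D^{\ge -i}\cap\mathcal T^{\ge 0}$, let $\mathcal H_i$ be its heart, and put $\mathcal X_i=\mathcal D_{i+1}^{\le 0}\cap\mathcal H_i$ and $\mathcal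 Y_i=\mathcal D_{i+1}^{\ge 1}\cap\mathcal H_i$. An object $A$ is *$\mathcal T$-static of degree $d$* if $A\in\mathcal H_{\mathcal T}[-d]$. **Theorem.** Let $(\mathcal D,\mathcal T)$ be a right filterable pair of $t$-structures of type $(n,0)$ on $\mathcal C$. Then $(\mathcal X_\ell,\mathcal Y_\ell)$ is a torsion pair in $\mathcal H_\ell$ for $0\le\ell\le n-1$, and every object $X$ of $\mathcal H_{\mathcal D}$ has a right $t$-tree, functorial in $X$: there are functors $X\mapsto X_{i_1\dots i_\ell}$ from $\mathcal H_{\mathcal D}$ to $\mathcal C$, one for each word $i_1\dots i_\ell$ in $\{0,1\}$ with $0\le\ell\le n$, the functor of the empty word being the inclusion (so the root is $X$ itself), and, for each word of length $\ell\le n-1$, natural transformations $X_{i_1\dots i_\ell 0}\to X_{i_1\dots i_\ell}\to X_{i_1\dots i_\ell 1}$, such that for every $X\in\mathcal H_{\mathcal D}$ and every word $i_1\dots i_\ell$ with $0\le \ell\le n-1$ the sequence $$0\to X_{i_1\dots i_\ell 0}\to X_{i_1\dots i_\ell}\to X_{i_1\dots i_\ell 1}\to 0$$ is a short exact sequence in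 $\mathcal H_\ell[-(i_1+\dots+i_\ell)]$ with $X_{i_1\dots i_\ell 0}\in\mathcal X_\ell[-(i_1+\dots+i_\ell)]$ and $X_{i_1\dots i_\ell 1}\in\mathcal Y_\ell[-(i_1+\dots+i_\ell)]$. Consequently, each of the $2^n$ leaves $X_{i_1\dots i_n}$ is $\mathcal T$-static of degree $i_1+\dots+i_n$. -/

import Mathlib

open CategoryTheory CategoryTheory.Limits CategoryTheory.Triangulated
  CategoryTheory.Pretriangulated

universe v u

namespace TTree

/-- `A ⟶ B ⟶ E` is a short exact sequence in the full subcategory `P`: the three objects lie in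
`P` and `0 → A → B → E → 0` is short exact there (kernels, cokernels, monomorphisms and
epimorphisms are those of the full subcategory, not those of the ambient category). -/
def ShortExactIn {C : Type u} [Category.{v} C] [Preadditive C] (P : ObjectProperty C)
    {A B E : C} (f : A ⟶ B) (g : B ⟶ E) : Prop :=
  ∃ (hA : P A) (hB : P B) (hE : P E) (w : f ≫ g = 0),
    (ShortComplex.mk (C := P.FullSubcategory)
      (X₁ := ⟨A, hA⟩) (X₂ := ⟨B, hB⟩) (X₃ := ⟨E, hE⟩)
      (ObjectProperty.homMk f) (ObjectProperty.homMk g)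
      (ObjectProperty.hom_ext P w)).ShortExact

/-- `(X, Y)` is a torsion pair in the full subcategory `P` (which is abelian in the
applications). -/
structure IsTorsionPairIn {C : Type u} [Category.{v} C] [Preadditive C] (P : ObjectProperty C)
    (X Y : ObjectProperty C) : Prop where
  left_le : X ≤ P
  right_le : Y ≤ P
  hom_eq_zero : ∀ ⦃A B : C⦄ (f : A ⟶ B), X A → Y B → f = 0
  exists_shortExact : ∀ ⦃B : C⦄, P B → ∃ (A E : C) (f : A ⟶ B) (g : B ⟶ E),
    X A ∧ Y E ∧ ShortExactIn P f g

section

variable {C : Type u} [Category.{v} C] [Preadditive C] [HasZeroObject C] [HasShift C ℤ]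
  [∀ k : ℤ, (shiftFunctor C k).Additive] [Pretriangulated C]

/-- An object is `T`-static of degree `d` if it lies in `H_T[-d]`, that is, `A[d]` lies in the
heart of `T`. -/
def IsStatic (T : TStructure C) (d : ℤ) (A : C) : Prop := (T.heart.shift d) A

/-- The pair `(D, T)` has type `(n, k)`: the shift `k` is the largest integer such that
`T^{≤ k} ⊆ D^{≤ 0}`, and the gap `n` is the least natural number such that
`D^{≤ -n} ⊆ T^{≤ k}`. -/
def IsOfType (D T : TStructure C) (n : ℕ) (k : ℤ) : Prop :=
  IsGreatest {j : ℤ | T.le j ≤ D.le 0} k ∧ IsLeast {m : ℕ | D.le (-(m : ℤ)) ≤ T.le k} n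

/-- A full subcategory is a co-aisle if it is the class `T^{≥ 0}` of some t-structure `T`. -/
def IsCoaisle (P : ObjectProperty C) : Prop := ∃ T : TStructure C, T.ge 0 = P

/-- The pair `(D, T)` is right filterable: `D^{≥ i} ∩ T^{≥ 0}` is a co-aisle for all `i`. -/
def RightFilterable (D T : TStructure C) : Prop := ∀ i : ℤ, IsCoaisle (D.ge i ⊓ T.ge 0)

/-- A t-structure is determined by its co-aisle. -/
theorem eq_of_ge_zero_eq {S T : TStructure C} (h : S.ge 0 = T.ge 0) : S = T := by
  have hge : S.ge = T.ge := by
    funext m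
    rw [← S.shift_ge m 0 m (by simp), ← T.shift_ge m 0 m (by simp), h]
  have hle : S.le = T.le := by
    funext m
    ext A
    rw [S.le_iff_isLE, T.le_iff_isLE, S.isLE_iff_orthogonal m (m + 1) rfl,
      T.isLE_iff_orthogonal m (m + 1) rfl]
    have key : ∀ Y : C, S.IsGE Y (m + 1) ↔ T.IsGE Y (m + 1) := fun Y => by
      rw [← S.ge_iff_isGE, ← T.ge_iff_isGE, hge]
    simp only [key]
  cases S
  cases T
  simp only at hge hle
  subst hge hle
  rfl

variable {D T : TStructure C}

/-- The right basic t-structure `D_i` of a right filterable pair `(D, T)`: the t-structure with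
co-aisle `D^{≥ -i} ∩ T^{≥ 0}`. -/
noncomputable def basic (h : RightFilterable D T) (i : ℤ) : TStructure C :=
  (h (-i)).choose

theorem basic_ge_zero (h : RightFilterable D T) (i : ℤ) :
    (basic h i).ge 0 = D.ge (-i) ⊓ T.ge 0 :=
  (h (-i)).choose_spec

/-- The right basic t-structure is the only t-structure with its defining property. -/
theorem eq_basic (h : RightFilterable D T) (i : ℤ) (S : TStructure C)
    (hS : S.ge 0 = D.ge (-i) ⊓ T.ge 0) : S = basic h i :=
  eq_of_ge_zero_eq (hS.trans (basic_ge_zero h i).symm)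

/-- The right basic heart `H_i`. -/
noncomputable def basicHeart (h : RightFilterable D T) (i : ℤ) : ObjectProperty C :=
  (basic h i).heart

/-- The right basic torsion class `X_i = D_{i+1}^{≤ 0} ∩ H_i`. -/
noncomputable def torsionClass (h : RightFilterable D T) (i : ℤ) : ObjectProperty C :=
  (basic h (i + 1)).le 0 ⊓ basicHeart h i

/-- The right basic torsion-free class `Y_i = D_{i+1}^{≥ 1} ∩ H_i`. -/
noncomputable def torsionFreeClass (h : RightFilterable D T) (i : ℤ) : ObjectProperty C :=
  (basic h (i + 1)).ge 1 ⊓ basicHeart h i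

end

/-- A vertex of the infinite binary tree, at the level given by the length of the list: the vertex
`i₁ i₂ … i_ℓ` is the list `[i_ℓ, …, i₂, i₁]`, its last letter first, so that its two children
`i₁ … i_ℓ 0` and `i₁ … i_ℓ 1` are `0 :: w` and `1 :: w`. -/
abbrev Word : Type := List (Fin 2)

/-- The degree `i₁ + ⋯ + i_ℓ` of a vertex. -/
def Word.degree (w : Word) : ℕ := (w.map Fin.val).sum

end TTree

/-!
Consecutive right basic t-structures are related by tilting: their co-aisles satisfy
`D_{i+1}^{≥ 1} ⊆ D_i^{≥ 0} ⊆ D_{i+1}^{≥ 0}`. If a t-structure `S` is such a tilt of `t`, the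
`S`-truncation triangle `S^{≤ d} X ⟶ X ⟶ S^{> d} X` of an object `X` of `H_t[-d]` has all its
vertices in `H_t[-d]`, where it is therefore a short exact sequence. Moreover the first vertex lies
in `H_S[-d]` and the last one in `H_S[-(d + 1)]`, so that both can be truncated again for a tilt of
`S`. The tree is obtained by iterating this along the chain that leads from `D_0 = D` to `D_n = T`.
-/

namespace TTree

open scoped ZeroObject

section ShortExact

theorem shortExact_of_isLimit_of_isColimit {A : Type*} [Category* A] [HasZeroMorphisms A]
    [HasZeroObject A] (S : ShortComplex A)
    (hf : IsLimit (KernelFork.ofι S.f S.zero)) (hg : IsColimit (CokernelCofork.ofπ S.g S.zero)) :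
    S.ShortExact := by
  have : Mono S.f := mono_of_isLimit_fork hf
  have : Epi S.g := epi_of_isColimit_cofork hg
  have lift_eq_id : hf.lift (KernelFork.ofι S.f S.zero) = 𝟙 S.X₁ :=
    Fork.IsLimit.hom_ext hf (by simp)
  have desc_eq_id : hg.desc (CokernelCofork.ofπ S.g S.zero) = 𝟙 S.X₃ :=
    Cofork.IsColimit.hom_ext hg (by simp)
  let left : S.LeftHomologyData :=
    { K := S.X₁, H := 0, i := S.f, π := 0, wi := S.zero, hi := hf, wπ := comp_zero
      hπ := CokernelCofork.IsColimit.ofEpiOfIsZero _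
        (lift_eq_id ▸ inferInstanceAs (Epi (𝟙 S.X₁))) (isZero_zero A) }
  let right : S.RightHomologyData :=
    { Q := S.X₃, H := 0, p := S.g, ι := 0, wp := S.zero, hp := hg, wι := zero_comp
      hι := KernelFork.IsLimit.ofMonoOfIsZero _
        (desc_eq_id ▸ inferInstanceAs (Mono (𝟙 S.X₃))) (isZero_zero A) }
  exact { exact := ⟨⟨left, right, Iso.refl _, by simp [left, right]⟩, isZero_zero A⟩ }

variable {C : Type*} [Category* C] [Preadditive C] [HasZeroObject C] [HasShift C ℤ]
  [∀ k : ℤ, (shiftFunctor C k).Additive] [Pretriangulated C]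

theorem isClosedUnderFiniteProducts_of_isTriangulatedClosed₂ (P : ObjectProperty C)
    [P.IsTriangulatedClosed₂] [P.IsClosedUnderIsomorphisms] [P.ContainsZero] :
    P.IsClosedUnderFiniteProducts := by
  have : P.IsClosedUnderBinaryProducts := .mk' fun _ ⟨F, hF⟩ =>
    P.prop_of_iso (HasLimit.isoOfNatIso (diagramIsoPair F)).symm
      (P.ext_of_isTriangulatedClosed₂ _ (binaryProductTriangle_distinguished _ _)
        (hF ⟨.left⟩) (hF ⟨.right⟩))
  exact .mk'

theorem shortExactIn_of_distTriang (P : ObjectProperty C)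
    [P.IsTriangulatedClosed₂] [P.IsClosedUnderIsomorphisms] [P.ContainsZero]
    (hP : ∀ ⦃X Y : C⦄ ⦃n : ℤ⦄ (f : X ⟶ Y⟦n⟧), P X → P Y → n < 0 → f = 0)
    {A B E : C} {f : A ⟶ B} {g : B ⟶ E} {h : E ⟶ A⟦(1 : ℤ)⟧}
    (hT : Triangle.mk f g h ∈ distTriang C) (hA : P A) (hB : P B) (hE : P E) :
    ShortExactIn P f g := by
  have := isClosedUnderFiniteProducts_of_isTriangulatedClosed₂ P
  have hι : ∀ ⦃X Y : P.FullSubcategory⦄ ⦃n : ℤ⦄ (k : P.ι.obj X ⟶ (P.ι.obj Y)⟦n⟧), n < 0 → k = 0 :=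
    fun X Y _ k => hP k X.property Y.property
  have := hasZeroObject_of_hasTerminal_object (C := P.FullSubcategory)
  exact ⟨hA, hB, hE, comp_distTriang_mor_zero₁₂ _ hT,
    shortExact_of_isLimit_of_isColimit _
      (AbelianSubcategory.isLimitKernelForkOfDistTriang (ι := P.ι) hι
        (X₁ := ⟨A, hA⟩) (X₂ := ⟨B, hB⟩) (X₃ := ⟨E, hE⟩)
        (ObjectProperty.homMk f) (ObjectProperty.homMk g) h hT)
      (AbelianSubcategory.isColimitCokernelCoforkOfDistTriang (ι := P.ι) hι
        (X₁ := ⟨A, hA⟩) (X₂ := ⟨B, hB⟩) (X₃ := ⟨E, hE⟩)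
        (ObjectProperty.homMk f) (ObjectProperty.homMk g) h hT)⟩

end ShortExact

variable {C : Type u} [Category.{v} C] [Preadditive C] [HasZeroObject C] [HasShift C ℤ]
  [∀ k : ℤ, (shiftFunctor C k).Additive] [Pretriangulated C]

section TStructure

variable (t : TStructure C)

instance isTriangulatedClosed₂_le (d : ℤ) : (t.le d).IsTriangulatedClosed₂ :=
  .mk' fun T hT h₁ h₃ => (t.isLE₂ T hT d ⟨h₁⟩ ⟨h₃⟩).le

instance isTriangulatedClosed₂_ge (d : ℤ) : (t.ge d).IsTriangulatedClosed₂ :=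
  .mk' fun T hT h₁ h₃ => (t.isGE₂ T hT d ⟨h₁⟩ ⟨h₃⟩).ge

instance containsZero_le (d : ℤ) : (t.le d).ContainsZero :=
  ⟨0, isZero_zero C, t.le_of_isLE 0 d⟩

instance containsZero_ge (d : ℤ) : (t.ge d).ContainsZero :=
  ⟨0, isZero_zero C, t.ge_of_isGE 0 d⟩

theorem heart_shift (d : ℤ) : t.heart.shift d = t.le d ⊓ t.ge d :=
  congrArg₂ (· ⊓ ·) (t.shift_le d 0 d (add_zero d)) (t.shift_ge d 0 d (add_zero d))

theorem shortExactIn_heart_shift (d : ℤ) {A B E : C} {f : A ⟶ B} {g : B ⟶ E}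
    {h : E ⟶ A⟦(1 : ℤ)⟧} (hT : Triangle.mk f g h ∈ distTriang C)
    (hA : t.heart.shift d A) (hB : t.heart.shift d B) (hE : t.heart.shift d E) :
    ShortExactIn (t.heart.shift d) f g := by
  rw [heart_shift] at *
  refine shortExactIn_of_distTriang _ (fun X Y n k hX hY hn => ?_) hT hA hB hE
  have : t.IsLE X d := ⟨hX.1⟩
  have : t.IsGE (Y⟦n⟧) (d - n) := ⟨t.ge_shift d n (d - n) (by lia) Y hY.2⟩
  exact t.zero k d (d - n) (by lia)

variable {S T : TStructure C} {a b : ℤ}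

theorem ge_add_le_ge_add (h : S.ge a ≤ T.ge b) (d : ℤ) : S.ge (a + d) ≤ T.ge (b + d) := by
  rw [← S.shift_ge d a _ (add_comm d a), ← T.shift_ge d b _ (add_comm d b)]
  exact fun X => h (X⟦d⟧)

theorem le_le_le_iff_ge_add_one_le : S.le a ≤ T.le b ↔ T.ge (b + 1) ≤ S.ge (a + 1) := by
  constructor
  · intro h X hX
    rw [S.ge_iff_isGE, S.isGE_iff_orthogonal a _ rfl]
    exact fun Y f hY => T.zero_of_isLE_of_isGE f b (b + 1) (by lia) ⟨h Y hY.le⟩ ⟨hX⟩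
  · intro h X hX
    rw [T.le_iff_isLE, T.isLE_iff_orthogonal b _ rfl]
    exact fun Y f hY => S.zero_of_isLE_of_isGE f a (a + 1) (by lia) ⟨hX⟩ ⟨h Y hY.ge⟩

theorem le_le_le_iff_ge_le_ge : S.le a ≤ T.le b ↔ T.ge b ≤ S.ge a := by
  rw [le_le_le_iff_ge_add_one_le]
  exact ⟨fun h => by simpa using ge_add_le_ge_add h (-1), fun h => ge_add_le_ge_add h 1⟩

end TStructure

/-- `S` is the Happel–Reiten–Smalø tilt of `t` at the torsion pair `(S^{≤ 0} ∩ H_t, S^{≥ 1} ∩ H_t)`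
of its heart; this is encoded as `S^{≥ 1} ⊆ t^{≥ 0} ⊆ S^{≥ 0}`. -/
structure IsTilt (t S : TStructure C) : Prop where
  ge_zero_le : t.ge 0 ≤ S.ge 0
  ge_one_le : S.ge 1 ≤ t.ge 0

namespace IsTilt

variable {t S : TStructure C} (hS : IsTilt t S)
include hS

theorem ge_le (d : ℤ) : t.ge d ≤ S.ge d := by
  simpa using ge_add_le_ge_add hS.ge_zero_le d

theorem ge_add_one_le (d : ℤ) : S.ge (d + 1) ≤ t.ge d := by
  simpa [add_comm] using ge_add_le_ge_add hS.ge_one_le d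

theorem le_le (d : ℤ) : S.le d ≤ t.le d :=
  le_le_le_iff_ge_le_ge.2 (hS.ge_le d)

theorem le_le_add_one (d : ℤ) : t.le d ≤ S.le (d + 1) :=
  le_le_le_iff_ge_le_ge.2 (hS.ge_add_one_le d)

theorem torsion_shift (d : ℤ) : (S.le 0 ⊓ t.heart).shift d = S.le d ⊓ t.ge d :=
  calc (S.le 0 ⊓ t.heart).shift d
    _ = (S.le 0).shift d ⊓ t.heart.shift d := rfl
    _ = S.le d ⊓ (t.le d ⊓ t.ge d) := by rw [S.shift_le d 0 d (add_zero d), heart_shift]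
    _ = S.le d ⊓ t.ge d := by rw [← inf_assoc, inf_eq_left.2 (hS.le_le d)]

theorem torsionFree_shift (d : ℤ) : (S.ge 1 ⊓ t.heart).shift d = t.le d ⊓ S.ge (d + 1) :=
  calc (S.ge 1 ⊓ t.heart).shift d
    _ = (S.ge 1).shift d ⊓ t.heart.shift d := rfl
    _ = S.ge (d + 1) ⊓ (t.le d ⊓ t.ge d) := by rw [S.shift_ge d 1 (d + 1) rfl, heart_shift]
    _ = t.le d ⊓ S.ge (d + 1) := by
      rw [inf_left_comm, inf_eq_left.2 (hS.ge_add_one_le d)]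

theorem torsion_shift_le_heart_shift (d : ℤ) :
    (S.le 0 ⊓ t.heart).shift d ≤ S.heart.shift d := by
  rw [hS.torsion_shift, heart_shift]
  exact inf_le_inf_left _ (hS.ge_le d)

theorem torsionFree_shift_le_heart_shift_add_one (d : ℤ) :
    (S.ge 1 ⊓ t.heart).shift d ≤ S.heart.shift (d + 1) := by
  rw [hS.torsionFree_shift, heart_shift]
  exact inf_le_inf_right _ (hS.le_le_add_one d)

variable {d : ℤ} {X : C}

theorem ge_truncLE (hX : t.ge d X) : t.ge d ((S.truncLE d).obj X) := by
  have hE : t.ge d ((S.truncGT d).obj X) := hS.ge_add_one_le d _ (S.ge_of_isGE _ _)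
  have hE' : t.ge d (((S.truncGT d).obj X)⟦(-1 : ℤ)⟧) :=
    t.ge_antitone (by lia) _ (t.ge_shift d (-1) (d + 1) (by lia) _ hE)
  exact (t.ge d).ext_of_isTriangulatedClosed₂ _
    (inv_rot_of_distTriang _ (S.triangleLEGT_distinguished d X)) hE' hX

theorem le_truncGT (hX : t.le d X) : t.le d ((S.truncGT d).obj X) := by
  have hA : t.le d ((S.truncLE d).obj X) := hS.le_le d _ (S.le_of_isLE _ _)
  have hA' : t.le d (((S.truncLE d).obj X)⟦(1 : ℤ)⟧) :=
    t.le_monotone (by lia) _ (t.le_shift d 1 (d - 1) (by lia) _ hA)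
  exact (t.le d).ext_of_isTriangulatedClosed₂ _
    (rot_of_distTriang _ (S.triangleLEGT_distinguished d X)) hX hA'

theorem torsion_shift_truncLE (hX : t.heart.shift d X) :
    (S.le 0 ⊓ t.heart).shift d ((S.truncLE d).obj X) := by
  rw [heart_shift] at hX
  rw [hS.torsion_shift]
  exact ⟨S.le_of_isLE _ d, hS.ge_truncLE hX.2⟩

theorem torsionFree_shift_truncGT (hX : t.heart.shift d X) :
    (S.ge 1 ⊓ t.heart).shift d ((S.truncGT d).obj X) := by
  rw [heart_shift] at hX
  rw [hS.torsionFree_shift]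
  exact ⟨hS.le_truncGT hX.1, S.ge_of_isGE _ (d + 1)⟩

theorem shortExactIn_trunc (hX : t.heart.shift d X) :
    ShortExactIn (t.heart.shift d) ((S.truncLEι d).app X) ((S.truncGTπ d).app X) :=
  shortExactIn_heart_shift t d (S.triangleLEGT_distinguished d X)
    (hS.torsion_shift_truncLE hX).2 hX (hS.torsionFree_shift_truncGT hX).2

theorem isTorsionPairIn : IsTorsionPairIn t.heart (S.le 0 ⊓ t.heart) (S.ge 1 ⊓ t.heart) where
  left_le := inf_le_right
  right_le := inf_le_right
  hom_eq_zero _ _ f hA hB := S.zero' f hA.1 hB.1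
  exists_shortExact B hB := by
    rw [← t.heart.shift_zero ℤ] at hB
    have hA := hS.torsion_shift_truncLE hB
    have hE := hS.torsionFree_shift_truncGT hB
    have hAE := hS.shortExactIn_trunc hB
    rw [ObjectProperty.shift_zero] at hA hE hAE
    exact ⟨_, _, _, _, hA, hE, hAE⟩

end IsTilt

theorem Word.degree_cons (i : Fin 2) (w : Word) : Word.degree (i :: w) = Word.degree w + i :=
  add_comm _ _

/-- The vertex `w` of the t-tree of an object, as a functor of that object, for a sequence `t` of
t-structures: the children of a vertex of level `l` and degree `d` are its truncations in degrees
`≤ d` and `> d` for `t (l + 1)`. -/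
noncomputable def treeFunctor (t : ℤ → TStructure C) : Word → C ⥤ C
  | [] => 𝟭 C
  | 0 :: w => treeFunctor t w ⋙ (t (w.length + 1)).truncLE (Word.degree w)
  | 1 :: w => treeFunctor t w ⋙ (t (w.length + 1)).truncGT (Word.degree w)

theorem heart_shift_treeFunctor {t : ℤ → TStructure C} (ht : ∀ i, IsTilt (t i) (t (i + 1)))
    {X : C} (hX : (t 0).heart X) (w : Word) :
    (t w.length).heart.shift (w.degree : ℤ) ((treeFunctor t w).obj X) := by
  induction w with
  | nil => exact ((t 0).heart.shift_zero ℤ).ge X hX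
  | cons i w ih =>
    have hw := ht w.length
    rw [List.length_cons, Nat.cast_succ]
    match i with
    | 0 =>
      rw [Word.degree_cons, Fin.val_zero, add_zero]
      exact hw.torsion_shift_le_heart_shift _ _ (hw.torsion_shift_truncLE ih)
    | 1 =>
      rw [Word.degree_cons, Fin.val_one, Nat.cast_succ]
      exact hw.torsionFree_shift_le_heart_shift_add_one _ _ (hw.torsionFree_shift_truncGT ih)

section Basic

variable {D T : TStructure C} (h : RightFilterable D T)

theorem basic_ge (i d : ℤ) : (basic h i).ge d = D.ge (d - i) ⊓ T.ge d := by
  rw [← (basic h i).shift_ge d 0 d (add_zero d), basic_ge_zero,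
    ← D.shift_ge d (-i) (d - i) (by lia), ← T.shift_ge d 0 d (add_zero d)]
  rfl

theorem isTilt_basic (i : ℤ) : IsTilt (basic h i) (basic h (i + 1)) where
  ge_zero_le := by
    rw [basic_ge, basic_ge]
    exact inf_le_inf_right _ (D.ge_antitone (by lia))
  ge_one_le := by
    rw [basic_ge, basic_ge]
    exact inf_le_inf (D.ge_antitone (by lia)) (T.ge_antitone zero_le_one)

theorem basic_zero (hTD : T.le 0 ≤ D.le 0) : basic h 0 = D := by
  refine (eq_basic h 0 D ?_).symm
  rw [neg_zero, inf_eq_left.2 (le_le_le_iff_ge_le_ge.1 hTD)]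

theorem basic_eq_right {i : ℤ} (hDT : D.le (-i) ≤ T.le 0) : basic h i = T :=
  (eq_basic h i T (inf_eq_right.2 (le_le_le_iff_ge_le_ge.1 hDT)).symm).symm

end Basic

end TTree

theorem mainTheorem4_general {C : Type u} [Category.{v} C] [Preadditive C] [HasZeroObject C]
    [HasShift C ℤ] [∀ k : ℤ, (shiftFunctor C k).Additive] [Pretriangulated C]
    (D T : TStructure C) (hDT : TTree.RightFilterable D T) (hTD : T.le 0 ≤ D.le 0) :
    (∀ l : ℤ, TTree.IsTorsionPairIn (TTree.basicHeart hDT l)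
      (TTree.torsionClass hDT l) (TTree.torsionFreeClass hDT l)) ∧
    ∃ (V : TTree.Word → (D.heart.FullSubcategory ⥤ C))
      (ι : ∀ w : TTree.Word, V (0 :: w) ⟶ V w)
      (π : ∀ w : TTree.Word, V w ⟶ V (1 :: w)),
      V [] = D.heart.ι ∧
      (∀ (w : TTree.Word) (X : D.heart.FullSubcategory),
        TTree.ShortExactIn ((TTree.basicHeart hDT w.length).shift (w.degree : ℤ))
          ((ι w).app X) ((π w).app X) ∧
        ((TTree.torsionClass hDT w.length).shift (w.degree : ℤ)) ((V (0 :: w)).obj X) ∧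
        ((TTree.torsionFreeClass hDT w.length).shift (w.degree : ℤ)) ((V (1 :: w)).obj X)) ∧
      (∀ w : TTree.Word, D.le (-(w.length : ℤ)) ≤ T.le 0 → ∀ X : D.heart.FullSubcategory,
        TTree.IsStatic T (w.degree : ℤ) ((V w).obj X)) := by
  have tilt := TTree.isTilt_basic hDT
  have mem_heart (X : D.heart.FullSubcategory) :=
    TTree.heart_shift_treeFunctor tilt (X := X.obj)
      (by simpa only [TTree.basic_zero hDT hTD] using X.property)
  let V (w : TTree.Word) := D.heart.ι ⋙ TTree.treeFunctor (TTree.basic hDT) w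
  refine ⟨fun l => (tilt l).isTorsionPairIn, V,
    fun w => (V w).whiskerLeft (TStructure.truncLEι _ _),
    fun w => (V w).whiskerLeft (TStructure.truncGTπ _ _), rfl, fun w X => ?_, fun w hw X => ?_⟩
  · exact ⟨(tilt w.length).shortExactIn_trunc (mem_heart X w),
      (tilt w.length).torsion_shift_truncLE (mem_heart X w),
      (tilt w.length).torsionFree_shift_truncGT (mem_heart X w)⟩
  · exact TTree.basic_eq_right hDT hw ▸ mem_heart X w

theorem mainTheorem4 {C : Type u} [Category.{v} C]
    [Preadditive C] [HasZeroObject C]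
    [HasShift C ℤ]
    [∀ k : ℤ, (shiftFunctor C k).Additive]
    [Pretriangulated C] [IsTriangulated C]
    (D T : TStructure C) (n : ℕ)
    (hDT : TTree.RightFilterable D T) (htype : TTree.IsOfType D T n 0) :
    -- the classes used below are torsion pairs in the right basic hearts
    (∀ l : ℕ, l < n → TTree.IsTorsionPairIn (TTree.basicHeart hDT l)
      (TTree.torsionClass hDT l) (TTree.torsionFreeClass hDT l)) ∧
    -- the vertices, as functors of the object of the heart, and the maps of the tree
    ∃ (V : TTree.Word → (D.heart.FullSubcategory ⥤ C))
      (ι : ∀ w : TTree.Word, V (0 :: w) ⟶ V w)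
      (π : ∀ w : TTree.Word, V w ⟶ V (1 :: w)),
      -- the root of the tree of `X` is `X`
      V [] = D.heart.ι ∧
      -- the short exact sequences, for the vertices of level `l = 0, …, n - 1`
      (∀ w : TTree.Word, w.length < n → ∀ X : D.heart.FullSubcategory,
        TTree.ShortExactIn ((TTree.basicHeart hDT w.length).shift (w.degree : ℤ))
          ((ι w).app X) ((π w).app X) ∧
        ((TTree.torsionClass hDT w.length).shift (w.degree : ℤ)) ((V (0 :: w)).obj X) ∧
        ((TTree.torsionFreeClass hDT w.length).shift (w.degree : ℤ)) ((V (1 :: w)).obj X)) ∧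
      -- the leaves
      (∀ w : TTree.Word, w.length = n → ∀ X : D.heart.FullSubcategory,
        TTree.IsStatic T (w.degree : ℤ) ((V w).obj X)) := by
  obtain ⟨torsionPair, V, ι, π, root, shortExact, static⟩ :=
    mainTheorem4_general D T hDT htype.1.1
  exact ⟨fun l _ => torsionPair l, V, ι, π, root, fun w _ => shortExact w,
    fun w hw => static w (hw ▸ htype.2.1)⟩
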